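/- Let $M(\phi,\xi,\eta,g_M)$ be a Sasakian manifold of dimension $2m+1$, that is, a Riemannian manifold with a $(1,1)$-tensor field $\phi$, a vector field $\xi$ and a 1-form $\eta$ such that $\phi^2=-I+\eta\otimes\xi$, $\phi\xi=0$, $\eta\circ\phi=0$, $\eta(\xi)=1$, $g_M(\phi X,\phi Y)=g_M(X,Y)-\eta(X)\eta(Y)$, $\eta(X)=g_M(X,\xi)$, $d\eta(X,Y)=g_M(X,\phi Y)$ and $[\phi,\phi]+2\,d\eta\otimes\xi=0$, where $2\,d\eta(X,Y)=X\eta(Y)-Y\eta(X)-\eta([X,Y])$ and $[\phi,\phi](X,Y)=\phi^2[X,Y]+[\phi X,\phi Y]-\phi[\phi X,Y]-\phi[X,\phi Y]$. Let $(N,g_N)$ be a Riemannian manifold of dimension $n$, and let $F:M\to N$ be an anti-invariant Riemannian submersion, i.e. a surjective smooth map of maximal rank $n$ whose differential preserves the lengths of horizontal vectors (those in $(\ker F_*)^\perp$), with $\phi(\ker F_*)\subseteq(\ker F_*)^{\perp}$. Assume that $\xi$ is vertical (tangent to the fibres) and that $\phi(\ker F_*)\cap(\ker F_*)^{\perp}\neq\{0\}$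 (equivalently, that the fibres have dimension $2m+1-n\ge 2$). Then no fibre of $F$ is totally umbilical: for no $q\in N$ does $$\mathcal T_UW=g_M(U,W)\,H$$ hold along $F^{-1}(q)$ for all vertical vector fields $U,W$. Here $\mathcal T_UW$ is the component in $(\ker F_*)^{\perp}$ of $\nabla_UW$, with $\nabla$ the Levi-Civita connection of $g_M$, and $H=\frac1{2m+1-n}\sum_j\mathcal T_{U_j}U_j$, for an orthonormal frame $(U_j)$ of $\ker F_*$, is the mean curvature vector field of the fibres. -/

import Mathlib

open Bundle Manifold
open scoped ContDiff

set_option linter.unusedSectionVars false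

noncomputable section

namespace SasakianGeometry

section LeviCivita

variable {E : Type*} [NormedAddCommGroup E] [NormedSpace ℝ E] [FiniteDimensional ℝ E]
  {H : Type*} [TopologicalSpace H] {I : ModelWithCorners ℝ E H}
  {M : Type*} [TopologicalSpace M] [ChartedSpace H M] [IsManifold I ∞ M]
  [RiemannianBundle (fun x : M => TangentSpace I x)]
  [IsContMDiffRiemannianBundle I ∞ E (fun x : M => TangentSpace I x)]

instance tangentSpaceFiniteDimensional (x : M) : FiniteDimensional ℝ (TangentSpace I x) :=
  inferInstanceAs (FiniteDimensional ℝ E)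

instance tangentSpaceComplete (x : M) : CompleteSpace (TangentSpace I x) :=
  FiniteDimensional.complete ℝ _

theorem mdifferentiableAt_inner {X Y : Π x : M, TangentSpace I x} {x : M}
    (hX : MDiffAt (T% X) x) (hY : MDiffAt (T% Y) x) :
    MDiffAt (fun y => inner ℝ (X y) (Y y)) x :=
  MDifferentiableAt.inner_bundle (F := E) (E := fun x : M => TangentSpace I x) (b := fun y => y)
    (v := X) (w := Y) hX hY

/-- Six-term Koszul expression, equal to `2 ⟨∇_X Y, Z⟩` at `x`. -/
def koszul (X Y Z : Π x : M, TangentSpace I x) (x : M) : ℝ :=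
  d% (fun y => inner ℝ (Y y) (Z y)) x (X x) + d% (fun y => inner ℝ (X y) (Z y)) x (Y x)
    - d% (fun y => inner ℝ (X y) (Y y)) x (Z x)
    + inner ℝ (VectorField.mlieBracket I X Y x) (Z x)
    - inner ℝ (VectorField.mlieBracket I X Z x) (Y x)
    - inner ℝ (VectorField.mlieBracket I Y Z x) (X x)

theorem koszul_tensorial_left {Y Z : Π x : M, TangentSpace I x} {x : M}
    (hY : MDiffAt (T% Y) x) (hZ : MDiffAt (T% Z) x) :
    TensorialAt I E (fun X => koszul X Y Z x) x where
  smul {f X} hf hX := by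
    have h1 := mvfderiv_fun_mul hf (mdifferentiableAt_inner hX hZ)
    have h2 := mvfderiv_fun_mul hf (mdifferentiableAt_inner hX hY)
    simp [koszul, inner_smul_left, inner_smul_right, h1, h2, VectorField.mlieBracket_smul_left hf hX, inner_add_left]
    simp only [real_inner_comm (X x)]
    ring
  add {X X'} hX hX' := by
    have h1 := mvfderiv_fun_add (mdifferentiableAt_inner hX hZ) (mdifferentiableAt_inner hX' hZ)
    have h2 := mvfderiv_fun_add (mdifferentiableAt_inner hX hY) (mdifferentiableAt_inner hX' hY)
    simp [koszul, inner_add_left, inner_add_right, h1, h2,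
      VectorField.mlieBracket_add_left hX hX']
    ring

theorem koszul_tensorial_right {X Y : Π x : M, TangentSpace I x} {x : M}
    (hX : MDiffAt (T% X) x) (hY : MDiffAt (T% Y) x) :
    TensorialAt I E (fun Z => koszul X Y Z x) x where
  smul {f Z} hf hZ := by
    have h1 := mvfderiv_fun_mul hf (mdifferentiableAt_inner hX hZ)
    have h2 := mvfderiv_fun_mul hf (mdifferentiableAt_inner hY hZ)
    simp [koszul, inner_smul_left, inner_smul_right, h1, h2,
      VectorField.mlieBracket_smul_right hf hZ, inner_add_left]
    simp only [real_inner_comm (Z x)]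
    ring
  add {Z Z'} hZ hZ' := by
    have h1 := mvfderiv_fun_add (mdifferentiableAt_inner hX hZ) (mdifferentiableAt_inner hX hZ')
    have h2 := mvfderiv_fun_add (mdifferentiableAt_inner hY hZ) (mdifferentiableAt_inner hY hZ')
    simp [koszul, inner_add_left, inner_add_right, h1, h2,
      VectorField.mlieBracket_add_right hZ hZ']
    ring

open Classical in
/-- `(X, Z) ↦ ⟨∇_X Y, Z⟩` at `x`. -/
def koszulForm (Y : Π x : M, TangentSpace I x) (x : M) :
    TangentSpace I x →L[ℝ] TangentSpace I x →L[ℝ] ℝ :=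
  if hY : MDiffAt (T% Y) x then
    (1 / 2 : ℝ) • TensorialAt.mkHom₂ (fun X Z => koszul X Y Z x) x
      (fun _ hZ => koszul_tensorial_left hY hZ) (fun _ hX => koszul_tensorial_right hX hY)
  else 0

theorem koszulForm_apply {X Y Z : Π x : M, TangentSpace I x} {x : M}
    (hX : MDiffAt (T% X) x) (hY : MDiffAt (T% Y) x) (hZ : MDiffAt (T% Z) x) :
    koszulForm Y x (X x) (Z x) = (1 / 2) * koszul X Y Z x := by
  rw [koszulForm, dif_pos hY]
  simp [TensorialAt.mkHom₂_apply (fun _ hZ => koszul_tensorial_left hY hZ) (fun _ hX => koszul_tensorial_right hX hY) hX hZ]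

/-- `lcFun Y x u` is `∇_u Y` at `x`, defined by `⟨∇_u Y, w⟩ = koszulForm Y x u w`. -/
def lcFun (Y : Π x : M, TangentSpace I x) (x : M) : TangentSpace I x →L[ℝ] TangentSpace I x :=
  InnerProductSpace.continuousLinearMapOfBilin (𝕜 := ℝ) (koszulForm Y x)

theorem inner_lcFun {X Y Z : Π x : M, TangentSpace I x} {x : M}
    (hX : MDiffAt (T% X) x) (hY : MDiffAt (T% Y) x) (hZ : MDiffAt (T% Z) x) :
    inner ℝ (lcFun Y x (X x)) (Z x) = (1 / 2) * koszul X Y Z x := by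
  rw [← koszulForm_apply hX hY hZ]
  exact InnerProductSpace.continuousLinearMapOfBilin_apply (𝕜 := ℝ) _ _ _
 

theorem lcFun_ext {x : M} {A B : TangentSpace I x →L[ℝ] TangentSpace I x}
    (h : ∀ X Z : Π x : M, TangentSpace I x, MDiffAt (T% X) x → MDiffAt (T% Z) x →
      (inner ℝ (A (X x)) (Z x) : ℝ) = inner ℝ (B (X x)) (Z x)) : A = B := by
  ext1 u
  refine ext_inner_right ℝ fun w => ?_
  simpa using h (FiberBundle.extend E u) (FiberBundle.extend E w)
    (FiberBundle.mdifferentiableAt_extend I E _) (FiberBundle.mdifferentiableAt_extend I E _)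

variable (I M) in
/-- The Levi-Civita connection of the Riemannian metric; `leviCivita I M Y x u` is `∇_u Y` at `x`. It
is torsion-free and metric by the two facts below, which determine it. -/
def leviCivita : CovariantDerivative I E (TangentSpace I : M → Type _) where
  toFun := lcFun
  isCovariantDerivativeOnUniv :=
    { add := by
        intro Y Y' x hY hY' _
        refine lcFun_ext fun X Z hX hZ => ?_
        have h1 := mvfderiv_fun_add (mdifferentiableAt_inner hY hZ) (mdifferentiableAt_inner hY' hZ)
        have h2 := mvfderiv_fun_add (mdifferentiableAt_inner hX hY) (mdifferentiableAt_inner hX hY')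
        rw [inner_lcFun hX (mdifferentiableAt_add_section hY hY') hZ,
          add_apply, inner_add_left, inner_lcFun hX hY hZ, inner_lcFun hX hY' hZ]
        simp [koszul, inner_add_left, inner_add_right, h1, h2,
          VectorField.mlieBracket_add_left hY hY', VectorField.mlieBracket_add_right hY hY']
        ring
      leibniz := by
        intro Y f x hY hf _
        refine lcFun_ext fun X Z hX hZ => ?_
        have h1 := mvfderiv_fun_mul hf (mdifferentiableAt_inner hY hZ)
        have h2 := mvfderiv_fun_mul hf (mdifferentiableAt_inner hX hY)
        rw [inner_lcFun hX (hf.smul_section hY) hZ, add_apply, inner_add_left,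
          FunLike.coe_smul, Pi.smul_apply, real_inner_smul_left,
          inner_lcFun hX hY hZ]
        simp [koszul, inner_add_left, inner_smul_left, inner_smul_right, h1, h2,
          VectorField.mlieBracket_smul_left hf hY, VectorField.mlieBracket_smul_right hf hY]
        simp only [real_inner_comm (X x)]
        ring }

theorem leviCivita_torsion : (leviCivita I M).torsion = 0 := by
  rw [CovariantDerivative.torsion_eq_zero_iff]
  intro X Y x hX hY
  refine ext_inner_right ℝ fun w => ?_
  have hw := FiberBundle.mdifferentiableAt_extend I E w
  have h1 := inner_lcFun hX hY hw
  have h2 := inner_lcFun hY hX hw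
  rw [FiberBundle.extend_apply_self] at h1 h2
  change inner ℝ (lcFun Y x (X x) - lcFun X x (Y x)) w = _
  rw [inner_sub_left, h1, h2, koszul, koszul, VectorField.mlieBracket_swap_apply (V := Y) (W := X),
    inner_neg_left]
  simp only [real_inner_comm (X _) (Y _), FiberBundle.extend_apply_self]
  ring

theorem leviCivita_metric {X Y Z : Π x : M, TangentSpace I x} {x : M}
    (hX : MDiffAt (T% X) x) (hY : MDiffAt (T% Y) x) (hZ : MDiffAt (T% Z) x) :
    d% (fun y => inner ℝ (Y y) (Z y)) x (X x) =
      inner ℝ (leviCivita I M Y x (X x)) (Z x) + inner ℝ (Y x) (leviCivita I M Z x (X x)) := by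
  have h1 := inner_lcFun hX hY hZ
  have h2 := inner_lcFun hX hZ hY
  change _ = inner ℝ (lcFun Y x (X x)) (Z x) + inner ℝ (Y x) (lcFun Z x (X x))
  rw [real_inner_comm _ (Y x), h1, h2, koszul, koszul,
    VectorField.mlieBracket_swap_apply (V := Z) (W := Y), inner_neg_left]
  simp only [real_inner_comm (Z _) (Y _)]
  ring

end LeviCivita

section Submersions

variable {E : Type*} [NormedAddCommGroup E] [NormedSpace ℝ E] [FiniteDimensional ℝ E]
  {H : Type*} [TopologicalSpace H] (I : ModelWithCorners ℝ E H)
  {M : Type*} [TopologicalSpace M] [ChartedSpace H M] [IsManifold I ∞ M]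
  [RiemannianBundle (fun x : M => TangentSpace I x)]
  [IsContMDiffRiemannianBundle I ∞ E (fun x : M => TangentSpace I x)]
  {E' : Type*} [NormedAddCommGroup E'] [NormedSpace ℝ E'] [FiniteDimensional ℝ E']
  {H' : Type*} [TopologicalSpace H'] (J : ModelWithCorners ℝ E' H')
  {N : Type*} [TopologicalSpace N] [ChartedSpace H' N] [IsManifold J ∞ N]
  [RiemannianBundle (fun y : N => TangentSpace J y)]
  [IsContMDiffRiemannianBundle J ∞ E' (fun y : N => TangentSpace J y)]

/-- The vertical space `ker F_*` at `x`. -/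
def verticalSpace (F : M → N) (x : M) : Submodule ℝ (TangentSpace I x) :=
  LinearMap.ker (mfderiv I J F x : TangentSpace I x →ₗ[ℝ] TangentSpace J (F x))

/-- The horizontal space `(ker F_*)ᗮ` at `x`. -/
def horizontalSpace (F : M → N) (x : M) : Submodule ℝ (TangentSpace I x) :=
  (verticalSpace I J F x)ᗮ

/-- Riemannian submersions: smooth maps onto `N`, of maximal rank, whose differential preserves the
lengths of horizontal vectors. -/
structure IsRiemannianSubmersion (F : M → N) : Prop where
  contMDiff : ContMDiff I J ∞ F
  surjective : Function.Surjective F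
  surjective_mfderiv : ∀ x, Function.Surjective (mfderiv I J F x)
  norm_mfderiv : ∀ x, ∀ v ∈ horizontalSpace I J F x, ‖mfderiv I J F x v‖ = ‖v‖

/-- The vertical part of a tangent vector. -/
def vert (F : M → N) (x : M) (v : TangentSpace I x) : TangentSpace I x :=
  (verticalSpace I J F x).starProjection v

/-- The horizontal part of a tangent vector. -/
def hor (F : M → N) (x : M) (v : TangentSpace I x) : TangentSpace I x :=
  (horizontalSpace I J F x).starProjection v

/-- O'Neill's tensor `𝒯_u Y = 𝓗 ∇_{𝓥u} 𝓥Y + 𝓥 ∇_{𝓥u} 𝓗Y` at the point `x`. It is tensorial in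
the first argument, which is therefore taken to be a tangent vector `u` at `x`. -/
def oneillT (F : M → N) (x : M) (u : TangentSpace I x) (Y : Π x : M, TangentSpace I x) :
    TangentSpace I x :=
  hor I J F x (leviCivita I M (fun y => vert I J F y (Y y)) x (vert I J F x u)) +
    vert I J F x (leviCivita I M (fun y => hor I J F y (Y y)) x (vert I J F x u))

/-- The mean curvature vector `(1 / k) ∑ⱼ 𝒯_{Uⱼ} Uⱼ` of the fibre through `x`, where the `Uⱼ` form an
orthonormal basis of the `k`-dimensional vertical space at `x`; in the second argument, `Uⱼ` is
extended to a vector field that is smooth near `x`. -/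
def meanCurvature (F : M → N) (x : M) : TangentSpace I x :=
  (1 / Module.finrank ℝ (verticalSpace I J F x) : ℝ) •
    ∑ j, oneillT I J F x (stdOrthonormalBasis ℝ (verticalSpace I J F x) j : TangentSpace I x)
      (FiberBundle.extend E (stdOrthonormalBasis ℝ (verticalSpace I J F x) j : TangentSpace I x))

/-- The fibre `F ⁻¹ {q}` is totally umbilical: `𝒯_U W = g(U, W) H` along it for all vertical `U` and
all vertical vector fields `W`, with `H` the mean curvature vector field. -/
def IsTotallyUmbilicalFibre (F : M → N) (q : N) : Prop :=
  ∀ W : Π x : M, TangentSpace I x, CMDiff ∞ (T% W) → (∀ x, W x ∈ verticalSpace I J F x) →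
    ∀ x, F x = q → ∀ u ∈ verticalSpace I J F x,
      oneillT I J F x u W = (inner ℝ u (W x) : ℝ) • meanCurvature I J F x

end Submersions

section Sasakian

variable {E : Type*} [NormedAddCommGroup E] [NormedSpace ℝ E] [FiniteDimensional ℝ E]
  {H : Type*} [TopologicalSpace H] (I : ModelWithCorners ℝ E H)
  (M : Type*) [TopologicalSpace M] [ChartedSpace H M] [IsManifold I ∞ M]

/-- An almost contact structure `(φ, ξ, η)`. -/
structure AlmostContactStructure where
  φ : Π x : M, TangentSpace I x →L[ℝ] TangentSpace I x
  ξ : Π x : M, TangentSpace I x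
  η : Π x : M, TangentSpace I x →L[ℝ] ℝ
  contMDiff_φ : ContMDiff I (I.prod 𝓘(ℝ, E →L[ℝ] E)) ∞
    (fun x => TotalSpace.mk' (E →L[ℝ] E)
      (E := fun x : M => TangentSpace I x →L[ℝ] TangentSpace I x) x (φ x))
  contMDiff_ξ : CMDiff ∞ (T% ξ)
  contMDiff_η : ContMDiff I (I.prod 𝓘(ℝ, E →L[ℝ] ℝ)) ∞
    (fun x => TotalSpace.mk' (E →L[ℝ] ℝ)
      (E := fun x : M => TangentSpace I x →L[ℝ] Bundle.Trivial M ℝ x) x (η x))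
  φ_φ : ∀ x v, φ x (φ x v) = -v + η x v • ξ x
  φ_ξ : ∀ x, φ x (ξ x) = 0
  η_φ : ∀ x v, η x (φ x v) = 0
  η_ξ : ∀ x, η x (ξ x) = 1

variable {I M}

/-- The exterior derivative of a 1-form, with the usual normalization of contact metric geometry:
`2 dη(X, Y) = X (η Y) - Y (η X) - η [X, Y]`. -/
def extDerivOneForm (η : Π x : M, TangentSpace I x →L[ℝ] ℝ) (X Y : Π x : M, TangentSpace I x)
    (x : M) : ℝ :=
  (1 / 2) * (d% (fun y => η y (Y y)) x (X x) - d% (fun y => η y (X y)) x (Y x)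
    - η x (VectorField.mlieBracket I X Y x))

/-- The Nijenhuis tensor
`[φ, φ](X, Y) = φ² [X, Y] + [φX, φY] - φ [φX, Y] - φ [X, φY]`. -/
def nijenhuis (φ : Π x : M, TangentSpace I x →L[ℝ] TangentSpace I x)
    (X Y : Π x : M, TangentSpace I x) (x : M) : TangentSpace I x :=
  φ x (φ x (VectorField.mlieBracket I X Y x))
    + VectorField.mlieBracket I (fun y => φ y (X y)) (fun y => φ y (Y y)) x
    - φ x (VectorField.mlieBracket I (fun y => φ y (X y)) Y x)
    - φ x (VectorField.mlieBracket I X (fun y => φ y (Y y)) x)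

variable (I M) in
/-- A Sasakian structure on a Riemannian manifold `(M, g)`: a normal contact metric structure
`(φ, ξ, η, g)`. -/
structure SasakianStructure [RiemannianBundle (fun x : M => TangentSpace I x)] extends
    AlmostContactStructure I M where
  inner_φ_φ : ∀ x (v w : TangentSpace I x),
    (inner ℝ (φ x v) (φ x w) : ℝ) = inner ℝ v w - η x v * η x w
  η_eq_inner : ∀ x (v : TangentSpace I x), η x v = inner ℝ v (ξ x)
  /-- Contact metric condition `dη(X, Y) = g(X, φY)`. -/
  contact : ∀ X Y : Π x : M, TangentSpace I x, CMDiff ∞ (T% X) → CMDiff ∞ (T% Y) →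
    ∀ x, extDerivOneForm η X Y x = inner ℝ (X x) (φ x (Y x))
  /-- Normality `[φ, φ] + 2 dη ⊗ ξ = 0`. -/
  normal : ∀ X Y : Π x : M, TangentSpace I x, CMDiff ∞ (T% X) → CMDiff ∞ (T% Y) →
    ∀ x, nijenhuis φ X Y x + (2 * extDerivOneForm η X Y x) • ξ x = 0

variable {E' : Type*} [NormedAddCommGroup E'] [NormedSpace ℝ E'] [FiniteDimensional ℝ E']
  {H' : Type*} [TopologicalSpace H'] (J : ModelWithCorners ℝ E' H')
  {N : Type*} [TopologicalSpace N] [ChartedSpace H' N] [IsManifold J ∞ N]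
  [RiemannianBundle (fun x : M => TangentSpace I x)]
  [RiemannianBundle (fun y : N => TangentSpace J y)]

/-- Anti-invariant Riemannian submersions: `φ (ker F_*) ⊆ (ker F_*)ᗮ`. -/
structure IsAntiInvariantSubmersion (S : SasakianStructure I M) (F : M → N) : Prop
    extends IsRiemannianSubmersion I J F where
  anti_invariant : ∀ x, (verticalSpace I J F x).map (S.φ x : TangentSpace I x →ₗ[ℝ] TangentSpace I x)
    ≤ horizontalSpace I J F x

end Sasakian

end SasakianGeometry

end

open SasakianGeometry

namespace SasakianGeometry

section Extension

variable {E : Type*} [NormedAddCommGroup E] [NormedSpace ℝ E] [FiniteDimensional ℝ E]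
  {H : Type*} [TopologicalSpace H] {I : ModelWithCorners ℝ E H}
  {M : Type*} [TopologicalSpace M] [T2Space M] [ChartedSpace H M] [IsManifold I ∞ M]

/-- Every tangent vector extends to a globally smooth vector field. -/
theorem exists_contMDiff_vectorField_apply_eq (x : M) (u : TangentSpace I x) :
    ∃ X : Π x : M, TangentSpace I x, CMDiff ∞ (T% X) ∧ X x = u := by
  obtain ⟨s, hs, hX⟩ := FiberBundle.exists_contMDiffOn_extend (k := ∞) I E u
  obtain ⟨t, hts, ht, hxt⟩ := mem_nhds_iff.1 hs
  obtain ⟨f, -, hf⟩ := (SmoothBumpFunction.nhds_basis_tsupport (I := I) x).mem_iff.1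
    (ht.mem_nhds hxt)
  refine ⟨(f : M → ℝ) • FiberBundle.extend E u, ContMDiffOn.smul_section_of_tsupport
    f.contMDiff.contMDiffOn ht hf (hX.mono hts), ?_⟩
  simp

end Extension

section Sasakian

variable {E : Type*} [NormedAddCommGroup E] [NormedSpace ℝ E] [FiniteDimensional ℝ E]
  {H : Type*} [TopologicalSpace H] {I : ModelWithCorners ℝ E H}
  {M : Type*} [TopologicalSpace M] [ChartedSpace H M] [IsManifold I ∞ M]

theorem AlmostContactStructure.contMDiff_φ_apply (S : AlmostContactStructure I M)
    {X : Π x : M, TangentSpace I x} (hX : CMDiff ∞ (T% X)) :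
    CMDiff ∞ (T% (fun x => S.φ x (X x))) := fun x =>
  ContMDiffAt.clm_bundle_apply (b := fun y : M => y) (S.contMDiff_φ x) (hX x)

variable [RiemannianBundle (fun x : M => TangentSpace I x)]

namespace SasakianStructure

variable (S : SasakianStructure I M)

theorem inner_ξ_ξ (x : M) : (inner ℝ (S.ξ x) (S.ξ x) : ℝ) = 1 := by
  rw [← S.η_eq_inner, S.η_ξ]

theorem inner_φ_ξ (x : M) (v : TangentSpace I x) : (inner ℝ (S.φ x v) (S.ξ x) : ℝ) = 0 := by
  rw [← S.η_eq_inner, S.η_φ]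

/-- `φ` is skew-symmetric. -/
theorem inner_φ_right (x : M) (v w : TangentSpace I x) :
    (inner ℝ v (S.φ x w) : ℝ) = -inner ℝ (S.φ x v) w := by
  have h := S.inner_φ_φ x v (S.φ x w)
  rw [S.φ_φ, S.η_φ, mul_zero, sub_zero, inner_add_right, inner_neg_right, inner_smul_right,
    S.inner_φ_ξ, mul_zero, add_zero] at h
  exact h.symm

theorem inner_apply_φ_self (x : M) (v : TangentSpace I x) :
    (inner ℝ v (S.φ x v) : ℝ) = 0 := by
  have h := S.inner_φ_right x v v
  rw [real_inner_comm v (S.φ x v)] at h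
  linarith

/-- The Lie derivative of `φ` along `ξ` takes values in the span of `ξ`. -/
theorem inner_mlieBracket_φ_ξ {X : Π x : M, TangentSpace I x} (hX : CMDiff ∞ (T% X)) {x : M}
    {u : TangentSpace I x} (hu : (inner ℝ u (S.ξ x) : ℝ) = 0) :
    (inner ℝ u (VectorField.mlieBracket I (fun y => S.φ y (X y)) S.ξ x) : ℝ) =
      inner ℝ u (S.φ x (VectorField.mlieBracket I X S.ξ x)) := by
  have hz : (fun y => S.φ y (S.ξ y)) = (0 : Π y : M, TangentSpace I y) := funext S.φ_ξ
  have hn := S.normal X S.ξ hX S.contMDiff_ξ x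
  rw [S.contact X S.ξ hX S.contMDiff_ξ x, nijenhuis, S.φ_ξ, hz,
    VectorField.mlieBracket_zero_right, VectorField.mlieBracket_zero_right] at hn
  simp only [Pi.zero_apply, map_zero, inner_zero_right, mul_zero, zero_smul, add_zero,
    sub_zero] at hn
  have h := congrArg (fun v => (inner ℝ u (S.φ x v) : ℝ)) hn
  simp only [map_sub, map_zero, S.φ_φ, inner_sub_right, inner_add_right, inner_neg_right,
    inner_smul_right, hu, mul_zero, add_zero, inner_zero_right, map_add, map_neg, map_smul,
    S.φ_ξ] at h
  linarith

variable [T2Space M] [IsContMDiffRiemannianBundle I ∞ E (fun x : M => TangentSpace I x)]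

/-- On a Sasakian manifold `g(∇_u ξ, φ u) = -g(u, u)` for `u` orthogonal to `ξ`. -/
theorem inner_leviCivita_ξ_φ {x : M} {u : TangentSpace I x}
    (hu : (inner ℝ u (S.ξ x) : ℝ) = 0) :
    (inner ℝ (leviCivita I M S.ξ x u) (S.φ x u) : ℝ) = -inner ℝ u u := by
  obtain ⟨X, hX, rfl⟩ := exists_contMDiff_vectorField_apply_eq x u
  have hY := S.contMDiff_φ_apply hX
  have hne : (∞ : WithTop ℕ∞) ≠ 0 := by simp
  have dX : MDiffAt (T% X) x := (hX x).mdifferentiableAt hne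
  have dY : MDiffAt (T% (fun y => S.φ y (X y))) x := (hY x).mdifferentiableAt hne
  have dξ : MDiffAt (T% S.ξ) x := (S.contMDiff_ξ x).mdifferentiableAt hne
  have tor : ∀ {V W : Π x : M, TangentSpace I x}, MDiffAt (T% V) x → MDiffAt (T% W) x →
      leviCivita I M W x (V x) - leviCivita I M V x (W x) = VectorField.mlieBracket I V W x :=
    fun hV hW => (CovariantDerivative.torsion_eq_zero_iff _).1 leviCivita_torsion hV hW
  have hconst : d% (fun _ : M => (0 : ℝ)) x = 0 := by simp [mvfderiv]
  have killing : (inner ℝ (X x) (leviCivita I M S.ξ x (S.φ x (X x))) : ℝ)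
      + inner ℝ (leviCivita I M S.ξ x (X x)) (S.φ x (X x)) = 0 := by
    have h := S.inner_mlieBracket_φ_ξ hX hu
    have hm := leviCivita_metric dξ dX dY
    simp only [S.inner_apply_φ_self] at hm
    rw [S.inner_φ_right, ← tor dY dξ, ← tor dX dξ, inner_sub_right, inner_sub_right] at h
    rw [hconst, zero_apply, real_inner_comm (S.φ x (X x))] at hm
    rw [real_inner_comm (S.φ x (X x))]
    linarith
  have hc := S.contact X _ hX hY x
  have hm₁ := leviCivita_metric dY dX dξ
  have hm₂ := leviCivita_metric dX dY dξ
  simp only [S.inner_φ_ξ] at hm₂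
  rw [extDerivOneForm, ← tor dX dY, S.φ_φ, S.η_eq_inner x (X x), hu] at hc
  simp only [S.η_φ, S.η_eq_inner, inner_sub_left, inner_add_right, inner_neg_right, zero_smul,
    inner_zero_right, hm₁, hconst, zero_apply] at hc
  rw [hconst, zero_apply] at hm₂
  rw [real_inner_comm (S.φ x (X x))] at killing ⊢
  linarith

end SasakianStructure

end Sasakian

section Submersion

variable {E : Type*} [NormedAddCommGroup E] [NormedSpace ℝ E] [FiniteDimensional ℝ E]
  {H : Type*} [TopologicalSpace H] {I : ModelWithCorners ℝ E H}
  {M : Type*} [TopologicalSpace M] [ChartedSpace H M] [IsManifold I ∞ M]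
  [RiemannianBundle (fun x : M => TangentSpace I x)]
  [IsContMDiffRiemannianBundle I ∞ E (fun x : M => TangentSpace I x)]
  {E' : Type*} [NormedAddCommGroup E'] [NormedSpace ℝ E'] [FiniteDimensional ℝ E']
  {H' : Type*} [TopologicalSpace H'] {J : ModelWithCorners ℝ E' H'}
  {N : Type*} [TopologicalSpace N] [ChartedSpace H' N] [IsManifold J ∞ N]
  [RiemannianBundle (fun y : N => TangentSpace J y)]
  [IsContMDiffRiemannianBundle J ∞ E' (fun y : N => TangentSpace J y)]
  {F : M → N}

/-- For vertical arguments, `𝒯_u W` is the horizontal part of `∇_u W`. -/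
theorem oneillT_of_vertical {x : M} {u : TangentSpace I x} {W : Π x : M, TangentSpace I x}
    (hu : u ∈ verticalSpace I J F x) (hW : ∀ y, W y ∈ verticalSpace I J F y) :
    oneillT I J F x u W = hor I J F x (leviCivita I M W x u) := by
  have hv : (fun y => vert I J F y (W y)) = W := funext fun y =>
    Submodule.starProjection_eq_self_iff.2 (hW y)
  have hh : (fun y => hor I J F y (W y)) = (0 : Π y : M, TangentSpace I y) := funext fun y =>
    (Submodule.starProjection_apply_eq_zero_iff _).2
      (Submodule.le_orthogonal_orthogonal _ (hW y))
  have hu' : vert I J F x u = u := Submodule.starProjection_eq_self_iff.2 hu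
  have h0 : leviCivita I M (0 : Π y : M, TangentSpace I y) x = 0 :=
    congrFun (CovariantDerivative.zero _) x
  rw [oneillT, hv, hh, hu', h0]
  simp [vert]

theorem inner_hor_of_mem {x : M} (v : TangentSpace I x) {w : TangentSpace I x}
    (hw : w ∈ horizontalSpace I J F x) :
    (inner ℝ (hor I J F x v) w : ℝ) = inner ℝ v w := by
  rw [hor, Submodule.inner_starProjection_left_eq_right,
    Submodule.starProjection_eq_self_iff.2 hw]

theorem finrank_verticalSpace_add (hF : IsRiemannianSubmersion I J F) (x : M) :
    Module.finrank ℝ (verticalSpace I J F x) + Module.finrank ℝ E' = Module.finrank ℝ E := by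
  have h := LinearMap.finrank_range_add_finrank_ker
    (mfderiv I J F x : TangentSpace I x →ₗ[ℝ] TangentSpace J (F x))
  rw [LinearMap.range_eq_top.2 (hF.surjective_mfderiv x), finrank_top] at h
  rw [add_comm]
  exact h

theorem finrank_verticalSpace_eq (hF : IsRiemannianSubmersion I J F) (x y : M) :
    Module.finrank ℝ (verticalSpace I J F x) = Module.finrank ℝ (verticalSpace I J F y) :=
  Nat.add_right_cancel
    ((finrank_verticalSpace_add hF x).trans (finrank_verticalSpace_add hF y).symm)

theorem one_lt_finrank_verticalSpace {S : SasakianStructure I M}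
    (hξ : ∀ x, S.ξ x ∈ verticalSpace I J F x) {x : M}
    (hφ : (verticalSpace I J F x).map (S.φ x : TangentSpace I x →ₗ[ℝ] TangentSpace I x) ≠ ⊥) :
    1 < Module.finrank ℝ (verticalSpace I J F x) := by
  by_contra! h
  refine hφ ((Submodule.eq_bot_iff _).2 ?_)
  rintro _ ⟨v, hv, rfl⟩
  have hne : (⟨S.ξ x, hξ x⟩ : verticalSpace I J F x) ≠ 0 := fun h0 => by
    have h1 := S.inner_ξ_ξ x
    rw [show S.ξ x = 0 from congrArg Subtype.val h0] at h1
    simp at h1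
  have h1 : Module.finrank ℝ (verticalSpace I J F x) = 1 :=
    le_antisymm h (Module.finrank_pos_iff_exists_ne_zero.2 ⟨_, hne⟩)
  obtain ⟨c, hc⟩ := exists_smul_eq_of_finrank_eq_one h1 hne ⟨v, hv⟩
  have hc' : c • S.ξ x = v := congrArg Subtype.val hc
  change S.φ x v = 0
  rw [← hc', map_smul, S.φ_ξ, smul_zero]

theorem exists_mem_verticalSpace_inner_ξ_eq_zero (S : SasakianStructure I M) {x : M}
    (h : 1 < Module.finrank ℝ (verticalSpace I J F x)) (hξ : S.ξ x ∈ verticalSpace I J F x) :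
    ∃ u ∈ verticalSpace I J F x, u ≠ 0 ∧ (inner ℝ u (S.ξ x) : ℝ) = 0 := by
  by_contra! hcon
  have hle : verticalSpace I J F x ≤ Submodule.span ℝ {S.ξ x} := fun v hv => by
    refine Submodule.mem_span_singleton.2 ⟨inner ℝ v (S.ξ x), ?_⟩
    by_contra hne
    refine hcon (v - (inner ℝ v (S.ξ x) : ℝ) • S.ξ x)
      (Submodule.sub_mem _ hv (Submodule.smul_mem _ _ hξ))
      (fun h0 => hne (sub_eq_zero.1 h0).symm) ?_
    rw [inner_sub_left, real_inner_smul_left, S.inner_ξ_ξ, mul_one, sub_self]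
  exact absurd h (not_lt.2 ((Submodule.finrank_mono hle).trans
    ((finrank_span_le_card _).trans (by simp))))

/-- For `u` vertical and orthogonal to `ξ`, `g(𝒯_u ξ, φ u) = -g(u, u)`. -/
theorem inner_oneillT_ξ_φ [T2Space M] {S : SasakianStructure I M}
    (hF : IsAntiInvariantSubmersion J S F) (hξ : ∀ x, S.ξ x ∈ verticalSpace I J F x) {x : M}
    {u : TangentSpace I x} (hu : u ∈ verticalSpace I J F x)
    (huξ : (inner ℝ u (S.ξ x) : ℝ) = 0) :
    (inner ℝ (oneillT I J F x u S.ξ) (S.φ x u) : ℝ) = -inner ℝ u u := by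
  have hφu : S.φ x u ∈ horizontalSpace I J F x :=
    hF.anti_invariant x (Submodule.mem_map_of_mem hu)
  rw [oneillT_of_vertical hu hξ, inner_hor_of_mem _ hφu, S.inner_leviCivita_ξ_φ huξ]

end Submersion

end SasakianGeometry

theorem theorem2 {m n : ℕ}
    {M : Type*} [TopologicalSpace M] [T2Space M] [SecondCountableTopology M]
    [ChartedSpace (EuclideanSpace ℝ (Fin (2 * m + 1))) M] [IsManifold (𝓡 (2 * m + 1)) ∞ M]
    [RiemannianBundle (fun x : M => TangentSpace (𝓡 (2 * m + 1)) x)]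
    [IsContMDiffRiemannianBundle (𝓡 (2 * m + 1)) ∞ (EuclideanSpace ℝ (Fin (2 * m + 1)))
      (fun x : M => TangentSpace (𝓡 (2 * m + 1)) x)]
    {N : Type*} [TopologicalSpace N] [T2Space N] [SecondCountableTopology N]
    [ChartedSpace (EuclideanSpace ℝ (Fin n)) N] [IsManifold (𝓡 n) ∞ N]
    [RiemannianBundle (fun y : N => TangentSpace (𝓡 n) y)]
    [IsContMDiffRiemannianBundle (𝓡 n) ∞ (EuclideanSpace ℝ (Fin n))
      (fun y : N => TangentSpace (𝓡 n) y)]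
    (S : SasakianStructure (𝓡 (2 * m + 1)) M) (F : M → N)
    (hF : IsAntiInvariantSubmersion (𝓡 n) S F)
    (hξ : ∀ x, S.ξ x ∈ verticalSpace (𝓡 (2 * m + 1)) (𝓡 n) F x)
    (hφ : ∃ x, (verticalSpace (𝓡 (2 * m + 1)) (𝓡 n) F x).map
        (S.φ x : TangentSpace (𝓡 (2 * m + 1)) x →ₗ[ℝ] TangentSpace (𝓡 (2 * m + 1)) x) ⊓
      horizontalSpace (𝓡 (2 * m + 1)) (𝓡 n) F x ≠ ⊥) :
    ∀ q : N, ¬ IsTotallyUmbilicalFibre (𝓡 (2 * m + 1)) (𝓡 n) F q := by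
  intro q hq
  obtain ⟨x, hx⟩ := hF.surjective q
  obtain ⟨x₀, hx₀⟩ := hφ
  have hk : 1 < Module.finrank ℝ (verticalSpace (𝓡 (2 * m + 1)) (𝓡 n) F x) := by
    rw [finrank_verticalSpace_eq hF.toIsRiemannianSubmersion x x₀]
    exact one_lt_finrank_verticalSpace hξ (ne_bot_of_le_ne_bot hx₀ inf_le_left)
  obtain ⟨u, hu, hu0, huξ⟩ := exists_mem_verticalSpace_inner_ξ_eq_zero S hk (hξ x)
  have h := inner_oneillT_ξ_φ hF hξ hu huξ
  rw [hq S.ξ S.contMDiff_ξ hξ x hx u hu, huξ, zero_smul, inner_zero_left] at h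
  exact hu0 (inner_self_eq_zero.1 (neg_eq_zero.1 h.symm))
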